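/- Let $G$ be a finite group of order $L \ge 2$. For $\tilde p \ge 0$ and $n \ge 1$ with $\tilde p \le \sqrt n$, let $\mathrm{ToH}_n(\tilde p, G)$ be the law of the random matrix $Y \in G^{n \times n}$ generated as follows. Draw $g_1, \dots, g_n$ independently and uniformly from $G$. Independently for each unordered pair $\{u,v\}$ with $u \ne v$, with probability $p = \tilde p/\sqrt n$ let $Y_{uv} = g_u g_v^{-1}$, and otherwise draw $Y_{uv}$ uniformly from $G$; put $Y_{vu} = Y_{uv}^{-1}$ and $Y_{uu} = 1$. Let $$\tilde p^*_L = \sqrt{\frac{2(L-1)\log(L-1)}{L(L-2)}} \quad (L \ge 3), \qquad \tilde p^*_2 = 1$$ (for $L = 2$ this is the limit value of the $0/0$ expression). Theorem. If $0 \le \tilde p < \tilde p^*_L$, then the truth-or-Haar model $\mathrm{ToH}_n(\tilde p, G)$ is contiguous to the unspiked model $\mathrm{ToH}_n(0, G)$ as $n \to \infty$: for every sequence of events $A_n \subseteq G^{n \times n}$, if $\Pr_{Y \sim \mathrm{ToH}_n(0,G)}[Y \in A_n] \to 0$ then $\Pr_{Y \sim \mathrm{ToH}_n(\tilde p,G)}[Y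 \in A_n] \to 0$. -/

import Mathlib

open MeasureTheory ProbabilityTheory Filter Topology

/-- A sequence of distributions `P n` is contiguous to `Q n` (on measurable spaces `Ω n`) if for
every sequence of events `A n`, `Q n (A n) → 0` implies `P n (A n) → 0`. -/
def IsContiguousTo {Ω : ℕ → Type*} [∀ n, MeasurableSpace (Ω n)]
    (P Q : ∀ n, Measure (Ω n)) : Prop :=
  ∀ A : ∀ n, Set (Ω n), (∀ n, MeasurableSet (A n)) →
    Tendsto (fun n => Q n (A n)) atTop (𝓝 0) → Tendsto (fun n => P n (A n)) atTop (𝓝 0)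

namespace ToH

/-- The unordered pairs `{u, v}` with `u ≠ v`, each represented by its ordering `u < v`. -/
abbrev Edge (n : ℕ) : Type := {e : Fin n × Fin n // e.1 < e.2}

/-- The observed matrix built from the group elements `g`, the coins `b` (`true` means that the
pair shows the true relative group element) and the random replacements `r`:
for `u < v`, `Y u v = g u * (g v)⁻¹` if the coin of the pair is `true` and `Y u v = r {u, v}`
otherwise; moreover `Y v u = (Y u v)⁻¹` and `Y u u = 1`. -/
def observe {G : Type*} [Group G] {n : ℕ}
    (g : Fin n → G) (b : Edge n → Bool) (r : Edge n → G) : Fin n → Fin n → G :=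
  let obs : Edge n → G := fun e => if b e = true then g e.1.1 * (g e.1.2)⁻¹ else r e
  fun u v =>
    if h : u < v then obs ⟨(u, v), h⟩
    else if h : v < u then (obs ⟨(v, u), h⟩)⁻¹
    else 1

/-- The probability `p = p̃ / √n` that a pair shows the truth. It is clamped to `[0, 1]`, which
for `p̃ ≥ 0` matters only when `n < p̃ ^ 2`, where the model is not defined otherwise. -/
noncomputable def truthProb (pt : ℝ) (n : ℕ) : unitInterval :=
  Set.projIcc (0 : ℝ) 1 zero_le_one (pt / √(n : ℝ))

/-- The uniform (Haar) probability measure on a finite group. -/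
noncomputable def haarUniform (G : Type*) [Group G] [Fintype G] [MeasurableSpace G] : Measure G :=
  (PMF.uniformOfFintype G).toMeasure

/-- The truth-or-Haar model on `n` vertices: the law of the matrix `observe g b r`, where all
`g u` and `r e` are uniform on `G`, all coins `b e` are `true` with probability `p̃ / √n`, and all
these variables are independent. -/
noncomputable def model (G : Type*) [Group G] [Fintype G] [MeasurableSpace G]
    (pt : ℝ) (n : ℕ) : Measure (Fin n → Fin n → G) :=
  Measure.map
    (fun ω : (Fin n → G) × (Edge n → Bool) × (Edge n → G) => observe ω.1 ω.2.1 ω.2.2)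
    ((Measure.pi fun _ : Fin n => haarUniform G).prod
      ((Measure.pi fun _ : Edge n => bernoulliMeasure true false (truthProb pt n)).prod
        (Measure.pi fun _ : Edge n => haarUniform G)))

/-- The critical value `√(2 (L - 1) log (L - 1) / (L (L - 2)))`, which is `1` (the limit value of
the `0 / 0` expression) for `L = 2`. -/
noncomputable def threshold (L : ℕ) : ℝ :=
  if L = 2 then 1
  else √(2 * ((L : ℝ) - 1) * Real.log ((L : ℝ) - 1) / ((L : ℝ) * ((L : ℝ) - 2)))

end ToH

/-! Second moment method. Let Q be the unspiked law, P the spiked one and ℓ the likelihood ratio. By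
Cauchy–Schwarz P(A)² ≤ Q(A) · E_Q[ℓ²], so contiguity follows once E_Q[ℓ²] is bounded uniformly in n
(`model_real_sq_le`). For two independent labellings g, h the edge densities correlate only through
k = h⁻¹g, which is uniform; hence E_Q[ℓ²] ≤ E exp(β/n · |D|²), where β = p̃²L/2 and D is the vector
of deviations of the counts of k from n/L (`sum_likelihood_sq_le`).

A Gaussian integral linearises |D|², and the expectation then factors over the vertices. It stays
bounded if the centred indicator vector of a uniform point has moment generating function at most
exp(|x|²/(4c)) with β < c (`sum_exp_sub_mean_le`, `sum_exp_deviation_sq_le`). By Gibbs duality this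
follows from the entropy inequality c · |α − 1/L|² ≤ KL(α ‖ uniform) (`entropyConst_mul_sq_le`). The
left convex function theorem `leftConvex_jensen` reduces the latter to vectors with all but one
coordinate equal, where it is the Kearns–Saul inequality `binaryGap_nonneg` (Pinsker,
`binaryGap_half_nonneg`, for L = 2). The threshold for p̃ is exactly β = c. -/

namespace ToH

/-! ### Quadratic lower bounds for binary relative entropy. -/

section BinaryEntropy

theorem hasDerivAt_log_sub_log_one_sub {t : ℝ} (h0 : 0 < t) (h1 : t < 1) :
    HasDerivAt (fun t => Real.log t - Real.log (1 - t)) (1 / t + 1 / (1 - t)) t := by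
  have h := (Real.hasDerivAt_log h0.ne').sub
    (((hasDerivAt_id t).const_sub 1).log (by simp; linarith))
  refine h.congr_deriv ?_
  simp [neg_div]

theorem hasDerivAt_inv_add_inv_one_sub {t : ℝ} (h0 : 0 < t) (h1 : t < 1) :
    HasDerivAt (fun t : ℝ => 1 / t + 1 / (1 - t)) (1 / (1 - t) ^ 2 - 1 / t ^ 2) t := by
  simp only [one_div]
  have h := (hasDerivAt_inv h0.ne').add
    (((hasDerivAt_id t).const_sub 1).inv (by simp; linarith))
  refine h.congr_deriv ?_
  simp; ring

theorem continuousOn_log_sub_log_one_sub {D : Set ℝ} (hD : D ⊆ Set.Ioo 0 1) :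
    ContinuousOn (fun t => Real.log t - Real.log (1 - t)) D := fun _ ht =>
  (hasDerivAt_log_sub_log_one_sub (hD ht).1 (hD ht).2).continuousAt.continuousWithinAt

theorem deriv2_log_sub_log_one_sub {t : ℝ} (h0 : 0 < t) (h1 : t < 1) :
    deriv^[2] (fun t => Real.log t - Real.log (1 - t)) t = 1 / (1 - t) ^ 2 - 1 / t ^ 2 := by
  have he : deriv (fun t => Real.log t - Real.log (1 - t)) =ᶠ[𝓝 t]
      fun t : ℝ => 1 / t + 1 / (1 - t) := by
    filter_upwards [Ioo_mem_nhds h0 h1] with x hx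
    exact (hasDerivAt_log_sub_log_one_sub hx.1 hx.2).deriv
  rw [Function.iterate_succ, Function.iterate_one, Function.comp_apply, he.deriv_eq]
  exact (hasDerivAt_inv_add_inv_one_sub h0 h1).deriv

theorem differentiableOn_log_sub_log_one_sub {D : Set ℝ} (hD : D ⊆ Set.Ioo 0 1) :
    DifferentiableOn ℝ (fun t => Real.log t - Real.log (1 - t)) D := fun _ ht =>
  (hasDerivAt_log_sub_log_one_sub (hD ht).1 (hD ht).2).differentiableAt.differentiableWithinAt

theorem differentiableOn_deriv_log_sub_log_one_sub {D : Set ℝ} (hD : D ⊆ Set.Ioo 0 1) :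
    DifferentiableOn ℝ (deriv fun t => Real.log t - Real.log (1 - t)) D := by
  intro t ht
  have he : deriv (fun t => Real.log t - Real.log (1 - t)) =ᶠ[𝓝 t]
      fun t : ℝ => 1 / t + 1 / (1 - t) := by
    filter_upwards [Ioo_mem_nhds (hD ht).1 (hD ht).2] with x hx
    exact (hasDerivAt_log_sub_log_one_sub hx.1 hx.2).deriv
  exact ((hasDerivAt_inv_add_inv_one_sub (hD ht).1 (hD
    ht).2).differentiableAt.congr_of_eventuallyEq he).differentiableWithinAt

/-- The derivative of `binaryGap` is the logit minus an affine function, so concavity left of 1/2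
and convexity right of it determine its sign from its zeros. -/
theorem concaveOn_log_sub_log_one_sub :
    ConcaveOn ℝ (Set.Ioc 0 (1 / 2)) (fun t => Real.log t - Real.log (1 - t)) := by
  have hI : Set.Ioo (0 : ℝ) (1 / 2) ⊆ Set.Ioo 0 1 := Set.Ioo_subset_Ioo_right (by norm_num)
  refine concaveOn_of_deriv2_nonpos (convex_Ioc _ _)
    (continuousOn_log_sub_log_one_sub fun t ht => ⟨ht.1, by linarith [ht.2]⟩) ?_ ?_ ?_
  · rw [interior_Ioc]; exact differentiableOn_log_sub_log_one_sub hI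
  · rw [interior_Ioc]; exact differentiableOn_deriv_log_sub_log_one_sub hI
  · rw [interior_Ioc]
    intro t ht
    rw [deriv2_log_sub_log_one_sub (hI ht).1 (hI ht).2, sub_nonpos]
    have := ht.1
    have := ht.2
    gcongr
    linarith

theorem convexOn_log_sub_log_one_sub :
    ConvexOn ℝ (Set.Ico (1 / 2) 1) (fun t => Real.log t - Real.log (1 - t)) := by
  have hI : Set.Ioo (1 / 2 : ℝ) 1 ⊆ Set.Ioo 0 1 := Set.Ioo_subset_Ioo_left (by norm_num)
  refine convexOn_of_deriv2_nonneg (convex_Ico _ _)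
    (continuousOn_log_sub_log_one_sub fun t ht => ⟨by linarith [ht.1], ht.2⟩) ?_ ?_ ?_
  · rw [interior_Ico]; exact differentiableOn_log_sub_log_one_sub hI
  · rw [interior_Ico]; exact differentiableOn_deriv_log_sub_log_one_sub hI
  · rw [interior_Ico]
    intro t ht
    rw [deriv2_log_sub_log_one_sub (hI ht).1 (hI ht).2, sub_nonneg]
    have := ht.1
    have := ht.2
    have : 0 < 1 - t := by linarith
    gcongr
    linarith

/-- The gap in the Kearns–Saul inequality. -/
noncomputable def binaryGap (p γ t : ℝ) : ℝ :=
  t * Real.log t + (1 - t) * Real.log (1 - t) - t * Real.log p - (1 - t) * Real.log (1 - p)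
    - γ * (t - p) ^ 2

theorem continuous_binaryGap (p γ : ℝ) : Continuous (binaryGap p γ) := by
  have h := Real.continuous_mul_log
  have h' : Continuous fun t : ℝ => (1 - t) * Real.log (1 - t) :=
    h.comp (continuous_const.sub continuous_id)
  unfold binaryGap
  fun_prop

theorem hasDerivAt_binaryGap (p γ : ℝ) {t : ℝ} (h0 : 0 < t) (h1 : t < 1) :
    HasDerivAt (binaryGap p γ) (Real.log t - Real.log (1 - t)
      - ((2 * γ) * t + (Real.log p - Real.log (1 - p) - 2 * γ * p))) t := by
  have hs : HasDerivAt (fun t : ℝ => 1 - t) (-1) t := (hasDerivAt_id t).const_sub 1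
  have h := ((((Real.hasDerivAt_mul_log h0.ne').add
    ((Real.hasDerivAt_mul_log (x := 1 - t) (by linarith)).comp t hs)).sub
    ((hasDerivAt_id t).mul_const (Real.log p))).sub (hs.mul_const (Real.log (1 - p)))).sub
    ((((hasDerivAt_id t).sub_const p).pow 2).const_mul γ)
  refine h.congr_deriv ?_
  simp; ring

theorem deriv_binaryGap (p γ : ℝ) {t : ℝ} (h0 : 0 < t) (h1 : t < 1) :
    deriv (binaryGap p γ) t = Real.log t - Real.log (1 - t)
      - ((2 * γ) * t + (Real.log p - Real.log (1 - p) - 2 * γ * p)) :=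
  (hasDerivAt_binaryGap p γ h0 h1).deriv

theorem convexOn_affine {D : Set ℝ} (hD : Convex ℝ D) (a b : ℝ) :
    ConvexOn ℝ D fun t => a * t + b := by
  refine ⟨hD, fun x _ y _ s t _ _ h => ?_⟩
  have : b = (s + t) * b := by rw [h, one_mul]
  simp only [smul_eq_mul]
  nlinarith

theorem concaveOn_affine {D : Set ℝ} (hD : Convex ℝ D) (a b : ℝ) :
    ConcaveOn ℝ D fun t => a * t + b := by
  refine ⟨hD, fun x _ y _ s t _ _ h => ?_⟩
  have : b = (s + t) * b := by rw [h, one_mul]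
  simp only [smul_eq_mul]
  nlinarith

/-- The Kearns–Saul inequality, for arguments to the right of the mean. -/
theorem binaryGap_nonneg {p γ t : ℝ} (hp0 : 0 < p) (hp : p < 1 / 2)
    (hγ : γ * (1 - 2 * p) = Real.log (1 - p) - Real.log p) (ht : t ∈ Set.Icc p 1) :
    0 ≤ binaryGap p γ t := by
  have hcc := concaveOn_log_sub_log_one_sub.sub (convexOn_affine (convex_Ioc 0 (1 / 2 : ℝ))
    (2 * γ) (Real.log p - Real.log (1 - p) - 2 * γ * p))
  have hcv := convexOn_log_sub_log_one_sub.sub (concaveOn_affine (convex_Ico (1 / 2 : ℝ) 1)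
    (2 * γ) (Real.log p - Real.log (1 - p) - 2 * γ * p))
  set φ : ℝ → ℝ := (fun t => Real.log t - Real.log (1 - t)) -
    fun t => (2 * γ) * t + (Real.log p - Real.log (1 - p) - 2 * γ * p) with hφ
  have hd : ∀ x, 0 < x → x < 1 → deriv (binaryGap p γ) x = φ x := fun x h0 h1 =>
    deriv_binaryGap p γ h0 h1
  have hdiff : ∀ x, 0 < x → x < 1 → DifferentiableAt ℝ (binaryGap p γ) x := fun x h0 h1 =>
    (hasDerivAt_binaryGap p γ h0 h1).differentiableAt
  have hφp : φ p = 0 := by simp [hφ]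
  -- The choice of γ makes 1/2 and 1 - p critical points besides p. The gap rises from 0 at p up to
  -- 1/2, falls back to 0 at 1 - p, and rises again.
  have hφh : φ (1 / 2) = 0 := by
    have : (1 - 1 / 2 : ℝ) = 1 / 2 := by norm_num
    simp only [hφ, Pi.sub_apply, this]
    linarith
  have hφq : φ (1 - p) = 0 := by
    simp only [hφ, Pi.sub_apply, sub_sub_cancel]
    linarith
  have hgp : binaryGap p γ p = 0 := by simp [binaryGap]
  have hgq : binaryGap p γ (1 - p) = 0 := by
    simp only [binaryGap, sub_sub_cancel]
    linear_combination -(1 - 2 * p) * hγ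
  have hcont : ∀ D, ContinuousOn (binaryGap p γ) D := fun D =>
    (continuous_binaryGap p γ).continuousOn
  have m1 : MonotoneOn (binaryGap p γ) (Set.Icc p (1 / 2)) := by
    refine monotoneOn_of_deriv_nonneg (convex_Icc _ _) (hcont _) ?_ ?_ <;>
      rw [interior_Icc] <;> intro x hx
    · exact (hdiff x (by linarith [hx.1]) (by linarith [hx.2])).differentiableWithinAt
    · rw [hd x (by linarith [hx.1]) (by linarith [hx.2])]
      have := hcc.min_le_of_mem_Icc (x := p) (y := 1 / 2) (z := x) ⟨hp0, hp.le⟩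
        ⟨by norm_num, le_rfl⟩ ⟨hx.1.le, hx.2.le⟩
      rwa [hφp, hφh, min_self] at this
  have m2 : AntitoneOn (binaryGap p γ) (Set.Icc (1 / 2) (1 - p)) := by
    refine antitoneOn_of_deriv_nonpos (convex_Icc _ _) (hcont _) ?_ ?_ <;>
      rw [interior_Icc] <;> intro x hx
    · exact (hdiff x (by linarith [hx.1]) (by linarith [hx.2])).differentiableWithinAt
    · rw [hd x (by linarith [hx.1]) (by linarith [hx.2])]
      have := hcv.le_max_of_mem_Icc (x := 1 / 2) (y := 1 - p) (z := x)
        ⟨le_rfl, by norm_num⟩ ⟨by linarith, by linarith⟩ ⟨hx.1.le, hx.2.le⟩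
      rwa [hφq, hφh, max_self] at this
  have m3 : MonotoneOn (binaryGap p γ) (Set.Icc (1 - p) 1) := by
    refine monotoneOn_of_deriv_nonneg (convex_Icc _ _) (hcont _) ?_ ?_ <;>
      rw [interior_Icc] <;> intro x hx
    · exact (hdiff x (by linarith [hx.1]) (by linarith [hx.2])).differentiableWithinAt
    · rw [hd x (by linarith [hx.1]) (by linarith [hx.2])]
      have := hcv.le_right_of_left_le'' (x := 1 / 2) (y := 1 - p) (z := x)
        ⟨le_rfl, by norm_num⟩ ⟨by linarith [hx.1], hx.2⟩ (by linarith) hx.1.le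
        (by rw [hφq, hφh])
      simpa [hφq] using this
  rcases le_total t (1 / 2) with h | h
  · rw [← hgp]
    exact m1 ⟨le_rfl, hp.le⟩ ⟨ht.1, h⟩ ht.1
  rcases le_total t (1 - p) with h' | h'
  · rw [← hgq]
    exact m2 ⟨h, h'⟩ ⟨by linarith, le_rfl⟩ h'
  · rw [← hgq]
    exact m3 ⟨le_rfl, by linarith⟩ ⟨h', ht.2⟩ h'

/-- The binary Pinsker inequality around `1 / 2`, for arguments to the right of the mean. -/
theorem binaryGap_half_nonneg {t : ℝ} (ht : t ∈ Set.Icc (1 / 2 : ℝ) 1) :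
    0 ≤ binaryGap (1 / 2) 2 t := by
  have hh : (1 - 1 / 2 : ℝ) = 1 / 2 := by norm_num
  have hder : ∀ x ∈ Set.Ioo (1 / 2 : ℝ) 1,
      0 ≤ Real.log x - Real.log (1 - x) - (4 * x - 2) := by
    have hI : ∀ x ∈ Set.Ico (1 / 2 : ℝ) 1, HasDerivAt
        (fun x => Real.log x - Real.log (1 - x) - (4 * x - 2)) (1 / x + 1 / (1 - x) - 4) x := by
      intro x hx
      have := (hasDerivAt_log_sub_log_one_sub (by linarith [hx.1]) hx.2).sub
        (((hasDerivAt_id x).const_mul 4).sub_const 2)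
      exact this.congr_deriv (by simp)
    have hm : MonotoneOn (fun x => Real.log x - Real.log (1 - x) - (4 * x - 2))
        (Set.Ico (1 / 2 : ℝ) 1) := by
      refine monotoneOn_of_deriv_nonneg (convex_Ico _ _)
        (fun x hx => (hI x hx).continuousAt.continuousWithinAt) ?_ ?_ <;>
        rw [interior_Ico] <;> intro x hx
      · exact (hI x ⟨hx.1.le, hx.2⟩).differentiableAt.differentiableWithinAt
      · rw [(hI x ⟨hx.1.le, hx.2⟩).deriv]
        have h0 : 0 < x := by linarith [hx.1]
        have h1 : 0 < 1 - x := by linarith [hx.2]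
        have : 1 / x + 1 / (1 - x) - 4 = (2 * x - 1) ^ 2 / (x * (1 - x)) := by
          field_simp; ring
        rw [this]
        positivity
    intro x hx
    have := hm ⟨le_rfl, by norm_num⟩ ⟨hx.1.le, hx.2⟩ hx.1.le
    simp only [hh] at this
    linarith
  have m : MonotoneOn (binaryGap (1 / 2) 2) (Set.Icc (1 / 2) 1) := by
    refine monotoneOn_of_deriv_nonneg (convex_Icc _ _)
      (continuous_binaryGap _ _).continuousOn ?_ ?_ <;>
      rw [interior_Icc] <;> intro x hx
    · exact (hasDerivAt_binaryGap _ _ (by linarith [hx.1])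
        hx.2).differentiableAt.differentiableWithinAt
    · rw [deriv_binaryGap _ _ (by linarith [hx.1]) hx.2, hh]
      linarith [hder x hx]
  have hg : binaryGap (1 / 2) 2 (1 / 2) = 0 := by simp [binaryGap]
  rw [← hg]
  exact m ⟨le_rfl, by norm_num⟩ ht ht.1

end BinaryEntropy

/-! ### Jensen's inequality for left convex functions. -/

/-- The left convex function theorem on the probability simplex: Jensen's inequality at the
barycentre holds for `f` that is only convex to the left of it, provided it holds for all points
with all but one coordinate equal. -/
theorem leftConvex_jensen {ι : Type*} [Fintype ι] {f : ℝ → ℝ} {n : ℝ}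
    (hn : (Fintype.card ι : ℝ) = n) (hn2 : 2 ≤ n)
    (hf : ConvexOn ℝ (Set.Icc 0 (1 / n)) f)
    (h1 : ∀ x ∈ Set.Icc (1 / n) 1, n * f (1 / n) ≤ f x + (n - 1) * f ((1 - x) / (n - 1)))
    {α : ι → ℝ} (hα : ∀ i, 0 ≤ α i) (hsum : ∑ i, α i = 1) :
    n * f (1 / n) ≤ ∑ i, f (α i) := by
  classical
  have hn0 : 0 < n := by linarith
  set u := 1 / n with hu
  have hnu : n * u = 1 := by rw [hu]; field_simp
  have hu0 : 0 < u := by positivity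
  set B := Finset.univ.filter fun i => u < α i with hB
  set S := Finset.univ.filter fun i => ¬ u < α i with hS
  have split : ∀ g : ι → ℝ, ∑ i ∈ B, g i + ∑ i ∈ S, g i = ∑ i, g i := fun g =>
    Finset.sum_filter_add_sum_filter_not _ _ _
  set k : ℝ := (B.card : ℝ) with hk
  set m : ℝ := (S.card : ℝ) with hm
  have hkm : k + m = n := by
    rw [← hn, hk, hm, ← Nat.cast_add, Finset.card_filter_add_card_filter_not, Finset.card_univ]
  have hSle : ∀ i ∈ S, α i ≤ u := fun i hi => not_lt.1 (Finset.mem_filter.1 hi).2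
  have hBlt : ∀ i ∈ B, u < α i := fun i hi => (Finset.mem_filter.1 hi).2
  have hα1 : ∀ i, α i ≤ 1 := fun i => hsum ▸ Finset.single_le_sum (fun j _ => hα j)
    (Finset.mem_univ i)
  have hSne : S.Nonempty := by
    by_contra h
    rw [Finset.not_nonempty_iff_eq_empty] at h
    have hm0 : m = 0 := by simp [hm, h]
    have h2 := split α
    rw [h, Finset.sum_empty, add_zero, hsum] at h2
    have hBne : B.Nonempty := by
      rw [Finset.nonempty_iff_ne_empty]; rintro h'; simp [h'] at h2
    have h3 : ∑ i ∈ B, u < ∑ i ∈ B, α i := Finset.sum_lt_sum_of_nonempty hBne hBlt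
    rw [Finset.sum_const, nsmul_eq_mul, ← hk, h2] at h3
    have : k = n := by linarith
    rw [this, hnu] at h3
    exact lt_irrefl _ h3
  have hm0 : 0 < m := by rw [hm]; exact_mod_cast hSne.card_pos
  set z := (∑ i ∈ S, α i) / m with hz
  have hmz : m * z = ∑ i ∈ S, α i := by rw [hz]; field_simp
  have hz0 : 0 ≤ z := div_nonneg (Finset.sum_nonneg fun i _ => hα i) hm0.le
  have hjen : m * f z ≤ ∑ i ∈ S, f (α i) := by
    have h := hf.map_sum_le (t := S) (w := fun _ => 1 / m) (p := α) (fun _ _ => by positivity)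
      (by rw [Finset.sum_const, nsmul_eq_mul, ← hm]; field_simp)
      (fun i hi => ⟨hα i, hSle i hi⟩)
    simp only [smul_eq_mul, ← Finset.mul_sum] at h
    have hz' : 1 / m * ∑ i ∈ S, α i = z := by rw [hz]; ring
    rw [hz'] at h
    calc m * f z ≤ m * (1 / m * ∑ i ∈ S, f (α i)) := by gcongr
      _ = _ := by field_simp
  have hsumB : ∑ i ∈ B, (α i - u) = m * (u - z) := by
    rw [Finset.sum_sub_distrib, Finset.sum_const, nsmul_eq_mul, ← hk]
    have := split α
    rw [hsum, ← hmz] at this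
    linear_combination this - hnu - hkm * u
  rcases B.eq_empty_or_nonempty with hBe | hBne
  · have hk0 : k = 0 := by simp [hk, hBe]
    rw [hBe, Finset.sum_empty] at hsumB
    have hzu : z = u := by
      rcases mul_eq_zero.1 hsumB.symm with h | h <;> linarith
    have := split fun i => f (α i)
    rw [hBe, Finset.sum_empty, zero_add] at this
    rw [← this, show n = m by linarith, ← hzu]
    exact hjen
  have hk1 : 1 ≤ k := by rw [hk]; exact_mod_cast hBne.card_pos
  have hpos : 0 < m * (u - z) := hsumB ▸ Finset.sum_pos (fun i hi => sub_pos.2 (hBlt i hi)) hBne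
  have huz : 0 < u - z := pos_of_mul_pos_right hpos hm0.le
  have hn1 : 0 < n - 1 := by linarith
  -- θ is chosen so that (1 - α i) / (n - 1) = (1 - θ i) u + θ i z. The weights sum to m / (n - 1),
  -- so adding `h1` over the large coordinates yields exactly the term m f(z) needed to absorb the
  -- Jensen bound on the small ones.
  set θ : ι → ℝ := fun i => (α i - u) / ((n - 1) * (u - z)) with hθ
  have hθsum : (n - 1) * ∑ i ∈ B, θ i = m := by
    rw [hθ, ← Finset.sum_div, hsumB]; field_simp
  have hθ0 : ∀ i ∈ B, 0 ≤ θ i := fun i hi =>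
    div_nonneg (sub_pos.2 (hBlt i hi)).le (by positivity)
  have hθ1 : ∀ i ∈ B, θ i ≤ 1 := fun i hi => by
    have h2 := Finset.single_le_sum hθ0 hi
    have h3 : (n - 1) * θ i ≤ n - 1 := by
      calc (n - 1) * θ i ≤ (n - 1) * ∑ i ∈ B, θ i := by gcongr
        _ ≤ n - 1 := by rw [hθsum]; linarith
    exact le_of_mul_le_mul_left (by linarith) hn1
  have hy : ∀ i ∈ B, f ((1 - α i) / (n - 1)) ≤ (1 - θ i) * f u + θ i * f z := fun i hi => by
    have h := hf.2 (⟨hu0.le, le_rfl⟩ : u ∈ Set.Icc 0 u) (⟨hz0, by linarith⟩ : z ∈ Set.Icc 0 u)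
      (by linarith [hθ1 i hi] : 0 ≤ 1 - θ i) (hθ0 i hi) (by ring)
    simp only [smul_eq_mul] at h
    have hθi : θ i * (u - z) * (n - 1) = α i - u := by simp only [hθ]; field_simp
    have hyi : (1 - α i) / (n - 1) = (1 - θ i) * u + θ i * z := by
      rw [div_eq_iff hn1.ne']
      linear_combination hθi - hnu
    rwa [hyi]
  have hBsum : ∑ i ∈ B, (n * f u - (n - 1) * ((1 - θ i) * f u + θ i * f z))
      ≤ ∑ i ∈ B, f (α i) := Finset.sum_le_sum fun i hi => by
    have h2 := h1 (α i) ⟨(hBlt i hi).le, hα1 i⟩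
    have h3 := mul_le_mul_of_nonneg_left (hy i hi) hn1.le
    linarith
  have heq : ∑ i ∈ B, (n * f u - (n - 1) * ((1 - θ i) * f u + θ i * f z))
      = n * f u - m * f z := by
    have : ∀ i, n * f u - (n - 1) * ((1 - θ i) * f u + θ i * f z)
        = f u + (n - 1) * θ i * (f u - f z) := fun i => by ring
    simp_rw [this]
    rw [Finset.sum_add_distrib, Finset.sum_const, nsmul_eq_mul, ← hk, ← Finset.sum_mul,
      ← Finset.mul_sum, hθsum]
    linear_combination hkm * f u
  rw [← split fun i => f (α i)]
  linarith

/-! ### Entropy against Euclidean distance on the simplex, and the dual sub-Gaussian bound. -/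

/-- The optimal constant in the comparison of relative entropy to the uniform law on `L` points
with the squared Euclidean distance. -/
noncomputable def entropyConst (L : ℕ) : ℝ :=
  if L = 2 then 1 else ((L : ℝ) - 1) * Real.log ((L : ℝ) - 1) / ((L : ℝ) - 2)

theorem three_le_cast {L : ℕ} (hL : 2 ≤ L) (h : L ≠ 2) : (3 : ℝ) ≤ L := by
  exact_mod_cast (by omega : 3 ≤ L)

theorem entropyConst_pos {L : ℕ} (hL : 2 ≤ L) : 0 < entropyConst L := by
  unfold entropyConst
  split_ifs with h
  · exact one_pos
  · have := three_le_cast hL h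
    have h1 : 0 < Real.log ((L : ℝ) - 1) := Real.log_pos (by linarith)
    have h2 : 0 < (L : ℝ) - 1 := by linarith
    have h3 : 0 < (L : ℝ) - 2 := by linarith
    positivity

/-- This makes t log t - c t² convex on [0, 1/L], where its second derivative is 1/t - 2c. For L ≥ 3
it is log x ≤ sinh (log x) = (x - 1/x)/2 at x = L - 1. -/
theorem entropyConst_le {L : ℕ} (hL : 2 ≤ L) : entropyConst L ≤ L / 2 := by
  unfold entropyConst
  split_ifs with h
  · simp [h]
  · have := three_le_cast hL h
    have h1 : 0 < Real.log ((L : ℝ) - 1) := Real.log_pos (by linarith)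
    have h2 : 0 < (L : ℝ) - 1 := by linarith
    have h3 : 0 < (L : ℝ) - 2 := by linarith
    have h4 := Real.self_le_sinh_iff.2 h1.le
    rw [Real.sinh_log h2] at h4
    rw [div_le_iff₀ h3]
    calc ((L : ℝ) - 1) * Real.log (L - 1)
        ≤ (L - 1) * (((L : ℝ) - 1 - ((L : ℝ) - 1)⁻¹) / 2) := by gcongr
      _ = _ := by field_simp; ring

theorem sq_mul_lt_entropyConst {L : ℕ} (hL : 2 ≤ L) {pt : ℝ} (h0 : 0 ≤ pt)
    (hpt : pt < threshold L) : pt ^ 2 * L / 2 < entropyConst L := by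
  unfold threshold at hpt
  unfold entropyConst
  split_ifs with h
  · rw [if_pos h] at hpt
    subst h
    push_cast
    nlinarith
  · rw [if_neg h] at hpt
    have := three_le_cast hL h
    have h3 : 0 < (L : ℝ) - 2 := by linarith
    have h4 := (Real.lt_sqrt h0).1 hpt
    calc pt ^ 2 * L / 2 < (2 * ((L : ℝ) - 1) * Real.log ((L : ℝ) - 1) / (L * (L - 2))) * L / 2 := by
          gcongr
      _ = _ := by field_simp

/-- The entropy inequality for one coordinate t and the others equal: the squared distance to the
barycentre is then (t - 1/L)² L/(L - 1). For L ≥ 3 the constant solves the Kearns–Saul condition at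
p = 1/L; for L = 2 that condition reads 0 = 0, and the limit γ = 2 is Pinsker's constant. -/
theorem entropyConst_binary {L : ℕ} (hL : 2 ≤ L) {t : ℝ} (ht : t ∈ Set.Icc (1 / (L : ℝ)) 1) :
    0 ≤ binaryGap (1 / L) (entropyConst L * L / (L - 1)) t := by
  by_cases h : L = 2
  · subst h
    have h2 : entropyConst 2 * ((2 : ℕ) : ℝ) / (((2 : ℕ) : ℝ) - 1) = 2 := by
      norm_num [entropyConst]
    rw [h2]
    push_cast at ht ⊢
    exact binaryGap_half_nonneg ht
  · have := three_le_cast hL h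
    have h2 : (L : ℝ) - 1 ≠ 0 := by linarith
    have h3 : (L : ℝ) - 2 ≠ 0 := by linarith
    have h0 : (L : ℝ) ≠ 0 := by linarith
    refine binaryGap_nonneg (by positivity) ?_ ?_ ht
    · rw [div_lt_div_iff₀ (by linarith) (by norm_num)]; linarith
    · rw [show (1 : ℝ) - 1 / L = (L - 1) / L by field_simp, Real.log_div h2 h0,
        Real.log_div one_ne_zero h0, entropyConst, if_neg h, Real.log_one]
      field_simp
      ring

theorem convexOn_mul_log_sub_sq {s c : ℝ} (hs : 2 * c * s ≤ 1) :
    ConvexOn ℝ (Set.Icc 0 s) fun t => t * Real.log t - c * t ^ 2 := by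
  have hd : ∀ x : ℝ, 0 < x → HasDerivAt (fun t => t * Real.log t - c * t ^ 2)
      (Real.log x + 1 - c * (2 * x)) x := fun x hx => by
    have := (Real.hasDerivAt_mul_log hx.ne').sub ((hasDerivAt_pow 2 x).const_mul c)
    exact this.congr_deriv (by simp)
  have hd2 : ∀ x : ℝ, 0 < x → HasDerivAt (deriv fun t => t * Real.log t - c * t ^ 2)
      (1 / x - c * 2) x := fun x hx => by
    have h1 : HasDerivAt (fun x => Real.log x + 1 - c * (2 * x)) (1 / x - c * 2) x := by
      have := ((Real.hasDerivAt_log hx.ne').add_const 1).sub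
        (((hasDerivAt_id x).const_mul 2).const_mul c)
      exact this.congr_deriv (by simp)
    refine h1.congr_of_eventuallyEq ?_
    filter_upwards [lt_mem_nhds hx] with y hy using (hd y hy).deriv
  refine convexOn_of_deriv2_nonneg (convex_Icc _ _)
    (Real.continuous_mul_log.sub (by fun_prop)).continuousOn ?_ ?_ ?_ <;>
    rw [interior_Icc] <;> intro x hx
  · exact (hd x hx.1).differentiableAt.differentiableWithinAt
  · exact (hd2 x hx.1).differentiableAt.differentiableWithinAt
  · rw [Function.iterate_succ, Function.iterate_one, Function.comp_apply, (hd2 x hx.1).deriv,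
      sub_nonneg, le_div_iff₀ hx.1]
    rcases le_total c 0 with hc | hc
    · nlinarith [hx.1]
    · nlinarith [hx.2]

/-- Relative entropy to the uniform law dominates the squared Euclidean distance. -/
theorem entropyConst_mul_sq_le {ι : Type*} [Fintype ι] {L : ℕ} (hcard : Fintype.card ι = L)
    (hL : 2 ≤ L) {α : ι → ℝ} (hα : ∀ i, 0 ≤ α i) (hsum : ∑ i, α i = 1) :
    entropyConst L * ∑ i, (α i - 1 / L) ^ 2 ≤ ∑ i, α i * Real.log (α i) + Real.log L := by
  have hL2 : (2 : ℝ) ≤ L := by exact_mod_cast hL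
  have hL0 : (0 : ℝ) < L := by linarith
  have hL1 : (0 : ℝ) < L - 1 := by linarith
  have hfu : (L : ℝ) * (1 / L * Real.log (1 / L) - entropyConst L * (1 / L) ^ 2)
      = -Real.log L - entropyConst L / L := by
    rw [one_div, Real.log_inv]; field_simp
  have hconv : ConvexOn ℝ (Set.Icc 0 (1 / (L : ℝ)))
      fun t => t * Real.log t - entropyConst L * t ^ 2 := by
    refine convexOn_mul_log_sub_sq ?_
    rw [mul_one_div, div_le_one hL0]
    linarith [entropyConst_le hL]
  have key := leftConvex_jensen (n := (L : ℝ)) (by exact_mod_cast hcard) hL2 hconv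
    (fun x hx => by
      have hb := entropyConst_binary hL hx
      have hlog : (1 - x) * Real.log ((1 - x) / (L - 1))
          = (1 - x) * Real.log (1 - x) - (1 - x) * Real.log (L - 1) := by
        rcases eq_or_ne (1 - x) 0 with h | h
        · simp [h]
        · rw [Real.log_div h hL1.ne']; ring
      have e : ((L : ℝ) - 1) * ((1 - x) / (L - 1) * Real.log ((1 - x) / (L - 1))
          - entropyConst L * ((1 - x) / (L - 1)) ^ 2)
          = (1 - x) * Real.log ((1 - x) / (L - 1)) - entropyConst L * (1 - x) ^ 2 / (L - 1) := by
        field_simp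
      simp only [hfu, e, hlog]
      rw [binaryGap, show (1 : ℝ) - 1 / L = (L - 1) / L by field_simp,
        Real.log_div hL1.ne' hL0.ne', one_div, Real.log_inv] at hb
      have e2 : entropyConst L * L / (L - 1) * (x - (L : ℝ)⁻¹) ^ 2
          = entropyConst L * x ^ 2 + entropyConst L * (1 - x) ^ 2 / (L - 1)
            - entropyConst L / L := by
        field_simp; ring
      rw [e2] at hb
      linarith) hα hsum
  rw [hfu, Finset.sum_sub_distrib, ← Finset.mul_sum] at key
  have e3 : ∑ i, (α i - 1 / (L : ℝ)) ^ 2 = ∑ i, α i ^ 2 - 1 / L := by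
    simp_rw [sub_sq]
    rw [Finset.sum_add_distrib, Finset.sum_sub_distrib, ← Finset.sum_mul, ← Finset.mul_sum, hsum,
      Finset.sum_const, Finset.card_univ, hcard, nsmul_eq_mul]
    field_simp; ring
  rw [e3, mul_sub, mul_one_div]
  linarith

/-- The centred indicator vector of a uniform point is sub-Gaussian with variance proxy
`1 / (2 * entropyConst L)`. -/
theorem sum_exp_sub_mean_le {ι : Type*} [Fintype ι] {L : ℕ} (hcard : Fintype.card ι = L)
    (hL : 2 ≤ L) (x : ι → ℝ) :
    ∑ i, Real.exp (x i - (∑ j, x j) / L)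
      ≤ L * Real.exp ((∑ i, x i ^ 2) / (4 * entropyConst L)) := by
  have hL0 : (0 : ℝ) < L := by exact_mod_cast (by omega : 0 < L)
  have hc := entropyConst_pos hL
  have : Nonempty ι := Fintype.card_pos_iff.1 (by omega)
  set Z := ∑ i, Real.exp (x i) with hZ
  have hZ0 : 0 < Z := Finset.sum_pos (fun i _ => Real.exp_pos _) Finset.univ_nonempty
  -- The Gibbs weights attain equality in the variational formula: log Z = ∑ α x - ∑ α log α.
  set α : ι → ℝ := fun i => Real.exp (x i) / Z with hα
  have hαsum : ∑ i, α i = 1 := by rw [hα, ← Finset.sum_div]; exact div_self hZ0.ne'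
  have hent := entropyConst_mul_sq_le hcard hL (α := α)
    (fun i => div_nonneg (Real.exp_pos _).le hZ0.le) hαsum
  have hlog : ∑ i, α i * Real.log (α i) = ∑ i, α i * x i - Real.log Z := by
    have : ∀ i, α i * Real.log (α i) = α i * x i - α i * Real.log Z := fun i => by
      simp only [hα]
      rw [Real.log_div (Real.exp_pos _).ne' hZ0.ne', Real.log_exp]; ring
    simp_rw [this]
    rw [Finset.sum_sub_distrib, ← Finset.sum_mul, hαsum, one_mul]
  have hmean : ∑ i, (α i - 1 / L) * x i = ∑ i, α i * x i - (∑ i, x i) / L := by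
    simp_rw [sub_mul]
    rw [Finset.sum_sub_distrib, ← Finset.mul_sum]; ring
  have hamgm : ∑ i, (α i - 1 / L) * x i
      ≤ entropyConst L * ∑ i, (α i - 1 / L) ^ 2 + (∑ i, x i ^ 2) / (4 * entropyConst L) := by
    rw [Finset.mul_sum, Finset.sum_div, ← Finset.sum_add_distrib]
    refine Finset.sum_le_sum fun i _ => ?_
    have : entropyConst L * (α i - 1 / L) ^ 2 + x i ^ 2 / (4 * entropyConst L)
        - (α i - 1 / L) * x i
        = (2 * entropyConst L * (α i - 1 / L) - x i) ^ 2 / (4 * entropyConst L) := by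
      field_simp; ring
    have h2 : 0 ≤ (2 * entropyConst L * (α i - 1 / L) - x i) ^ 2 / (4 * entropyConst L) := by
      positivity
    linarith
  have hfin : Real.log Z - (∑ j, x j) / L
      ≤ Real.log L + (∑ i, x i ^ 2) / (4 * entropyConst L) := by linarith
  calc ∑ i, Real.exp (x i - (∑ j, x j) / L) = Real.exp (Real.log Z - (∑ j, x j) / L) := by
        simp_rw [Real.exp_sub]
        rw [← Finset.sum_div, Real.exp_log hZ0]
    _ ≤ Real.exp (Real.log L + (∑ i, x i ^ 2) / (4 * entropyConst L)) := Real.exp_le_exp.2 hfin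
    _ = _ := by rw [Real.exp_add, Real.exp_log hL0]


/-! ### Gaussian linearisation and the exponential moment of multinomial deviations. -/

theorem exp_linear_sub_sq (t z : ℝ) :
    Real.exp (t * z - z ^ 2 / 2)
      = Real.exp (t ^ 2 / 2) * Real.exp (-(1 / 2) * (z - t) ^ 2) := by
  rw [← Real.exp_add]; ring_nf

theorem integrable_exp_linear_sub_sq (t : ℝ) :
    Integrable fun z : ℝ => Real.exp (t * z - z ^ 2 / 2) := by
  simp_rw [exp_linear_sub_sq]
  exact ((integrable_exp_neg_mul_sq (by norm_num : (0 : ℝ) < 1 / 2)).comp_sub_right t).const_mul _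

theorem integral_exp_linear_sub_sq (t : ℝ) :
    ∫ z : ℝ, Real.exp (t * z - z ^ 2 / 2) = Real.exp (t ^ 2 / 2) * √(2 * Real.pi) := by
  simp_rw [exp_linear_sub_sq]
  rw [integral_const_mul, integral_sub_right_eq_self fun z : ℝ => Real.exp (-(1 / 2) * z ^ 2),
    integral_gaussian]
  congr 2
  ring

/-- The Hubbard–Stratonovich transform on a finite-dimensional space. -/
theorem integral_prod_exp_linear_sub_sq {ι : Type*} [Fintype ι] (t : ι → ℝ) :
    ∫ z : ι → ℝ, ∏ i, Real.exp (t i * z i - z i ^ 2 / 2)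
      = Real.exp (∑ i, t i ^ 2 / 2) * √(2 * Real.pi) ^ Fintype.card ι := by
  rw [integral_fintype_prod_volume_eq_prod fun i z => Real.exp (t i * z - z ^ 2 / 2)]
  simp_rw [integral_exp_linear_sub_sq]
  rw [Finset.prod_mul_distrib, Real.exp_sum, Finset.prod_const, Finset.card_univ]

open scoped Classical in
/-- The deviation of the number of visits of `k` to `a` from `n / L`. -/
noncomputable def deviation {G : Type*} (L : ℕ) {n : ℕ} (k : Fin n → G) (a : G) : ℝ :=
  ∑ u, (if k u = a then (1 : ℝ) else 0) - n / L

/-- Linear forms in the deviations are additive over vertices, so their exponentials factor when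
summed over k. -/
theorem sum_deviation_mul {G : Type*} [Fintype G] (L : ℕ) {n : ℕ} (k : Fin n → G) (x : G → ℝ) :
    ∑ a, deviation L k a * x a = ∑ u, (x (k u) - (∑ a, x a) / L) := by
  classical
  simp_rw [deviation, sub_mul]
  rw [Finset.sum_sub_distrib, Finset.sum_sub_distrib, ← Finset.mul_sum, Finset.sum_const,
    Finset.card_univ, Fintype.card_fin, nsmul_eq_mul]
  congr 1
  · simp_rw [Finset.sum_mul]
    rw [Finset.sum_comm]
    simp
  · ring

/-- The exponential moment of the squared multinomial deviation is bounded uniformly in `n`. -/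
theorem sum_exp_deviation_sq_le {G : Type*} [Fintype G] {L : ℕ} (hcard : Fintype.card G = L)
    (hL : 2 ≤ L) {β : ℝ} (hβ0 : 0 ≤ β) (hβ : β < entropyConst L) {n : ℕ} (hn : 1 ≤ n) :
    ∑ k : Fin n → G, Real.exp (β / n * ∑ a, deviation L k a ^ 2)
      ≤ (L : ℝ) ^ n * √(1 / (1 - β / entropyConst L)) ^ L := by
  classical
  have hc := entropyConst_pos hL
  set c := entropyConst L with hcdef
  have hn0 : (0 : ℝ) < n := by exact_mod_cast hn
  have hd : 0 < 1 - β / c := by rw [sub_pos, div_lt_one hc]; exact hβ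
  -- With s²/2 = β/n the Gaussian integral of exp(s D·z) reproduces exp(β/n · |D|²).
  set s := √(2 * β / n) with hs
  have hs2 : s ^ 2 = 2 * β / n := Real.sq_sqrt (by positivity)
  have hpi : 0 < √(2 * Real.pi) := by positivity
  have hint : ∀ k : Fin n → G, Integrable fun z : G → ℝ =>
      ∏ a, Real.exp (s * deviation L k a * z a - z a ^ 2 / 2) := fun k =>
    Integrable.fintype_prod (f := fun a z => Real.exp (s * deviation L k a * z - z ^ 2 / 2))
      fun a => integrable_exp_linear_sub_sq _
  have hint2 : Integrable fun z : G → ℝ => ∏ a, Real.exp (-((1 - β / c) / 2) * z a ^ 2) :=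
    Integrable.fintype_prod (f := fun _ z => Real.exp (-((1 - β / c) / 2) * z ^ 2))
      fun a => integrable_exp_neg_mul_sq (by positivity)
  have hpt : ∀ z : G → ℝ, ∑ k : Fin n → G,
      ∏ a, Real.exp (s * deviation L k a * z a - z a ^ 2 / 2)
        ≤ (L : ℝ) ^ n * ∏ a, Real.exp (-((1 - β / c) / 2) * z a ^ 2) := by
    intro z
    have e1 : ∀ k : Fin n → G, ∏ a, Real.exp (s * deviation L k a * z a - z a ^ 2 / 2)
        = (∏ u, Real.exp (s * z (k u) - (∑ a, s * z a) / L)) * Real.exp (-∑ a, z a ^ 2 / 2) := by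
      intro k
      rw [← Real.exp_sum, ← Real.exp_sum, ← Real.exp_add,
        ← sum_deviation_mul L k fun a => s * z a, Finset.sum_sub_distrib, sub_eq_add_neg]
      congr 3 with a
      ring
    simp_rw [e1]
    rw [← Finset.sum_mul, ← Fintype.sum_pow fun a => Real.exp (s * z a - (∑ a, s * z a) / L)]
    have h2 := sum_exp_sub_mean_le hcard hL fun a => s * z a
    -- The n sub-Gaussian factors contribute n s²/(4c) = β/(2c) to the coefficient of |z|², so the
    -- total is -(1 - β/c)/2, independent of n and negative because β < c.
    calc (∑ a, Real.exp (s * z a - (∑ a, s * z a) / L)) ^ n * Real.exp (-∑ a, z a ^ 2 / 2)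
        ≤ (L * Real.exp ((∑ a, (s * z a) ^ 2) / (4 * c))) ^ n
            * Real.exp (-∑ a, z a ^ 2 / 2) := by
          gcongr
      _ = (L : ℝ) ^ n * ∏ a, Real.exp (-((1 - β / c) / 2) * z a ^ 2) := by
          rw [mul_pow, ← Real.exp_nat_mul, mul_assoc, ← Real.exp_add, ← Real.exp_sum,
            ← Finset.mul_sum, ← Finset.sum_div]
          simp_rw [mul_pow]
          rw [← Finset.mul_sum, hs2]
          congr 2
          field_simp
          ring
  have hleft : ∫ z : G → ℝ, ∑ k : Fin n → G,
      ∏ a, Real.exp (s * deviation L k a * z a - z a ^ 2 / 2)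
        = (∑ k : Fin n → G, Real.exp (β / n * ∑ a, deviation L k a ^ 2))
          * √(2 * Real.pi) ^ L := by
    rw [integral_finsetSum _ fun k _ => hint k, Finset.sum_mul]
    refine Finset.sum_congr rfl fun k _ => ?_
    rw [integral_prod_exp_linear_sub_sq fun a => s * deviation L k a, hcard, Finset.mul_sum]
    congr 3 with a
    rw [mul_pow, hs2]
    ring
  have hright : ∫ z : G → ℝ, (L : ℝ) ^ n * ∏ a, Real.exp (-((1 - β / c) / 2) * z a ^ 2)
      = ((L : ℝ) ^ n * √(1 / (1 - β / c)) ^ L) * √(2 * Real.pi) ^ L := by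
    rw [integral_const_mul, integral_fintype_prod_volume_eq_pow
      fun z : ℝ => Real.exp (-((1 - β / c) / 2) * z ^ 2), hcard, integral_gaussian, mul_assoc,
      ← mul_pow, ← Real.sqrt_mul (by positivity)]
    congr 3
    field_simp
  have := integral_mono (integrable_finsetSum _ fun k _ => hint k) (hint2.const_mul _) hpt
  rw [hleft, hright] at this
  exact le_of_mul_le_mul_right this (by positivity)

/-! ### From products over edges to squared deviations. -/

theorem two_mul_sum_edge_le {n : ℕ} (f : Fin n → Fin n → ℝ) (hsymm : ∀ u v, f u v = f v u)
    (hdiag : ∀ u, 0 ≤ f u u) : 2 * ∑ e : Edge n, f e.1.1 e.1.2 ≤ ∑ u, ∑ v, f u v := by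
  have hE : ∑ e : Edge n, f e.1.1 e.1.2
      = ∑ x : Fin n × Fin n with x.1 < x.2, f x.1 x.2 :=
    (Finset.sum_subtype _ (by simp) fun x : Fin n × Fin n => f x.1 x.2).symm
  have hE' : ∑ e : Edge n, f e.1.1 e.1.2
      = ∑ x : Fin n × Fin n with x.2 < x.1, f x.1 x.2 := by
    rw [hE]
    refine Finset.sum_equiv (Equiv.prodComm _ _) (by simp) fun x _ => hsymm _ _
  rw [← Fintype.sum_prod_type', two_mul]
  nth_rw 1 [hE]
  rw [hE', ← Finset.sum_filter_add_sum_filter_not Finset.univ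
    fun x : Fin n × Fin n => x.1 < x.2]
  refine add_le_add le_rfl (Finset.sum_le_sum_of_subset_of_nonneg ?_ ?_)
  · intro x
    simp only [Finset.mem_filter, Finset.mem_univ, true_and, not_lt]
    exact le_of_lt
  · intro x hx hx'
    simp only [Finset.mem_filter, Finset.mem_univ, true_and, not_lt] at hx hx'
    rw [le_antisymm hx hx']
    exact hdiag _

open scoped Classical in
-- The summand is L times the inner product of the centred indicator vectors of k u and k v, so the
-- double sum is a squared norm.
theorem sum_pairs_eq {G : Type*} [Fintype G] {L : ℕ} (hcard : Fintype.card G = L) (hL : 2 ≤ L)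
    {n : ℕ} (k : Fin n → G) :
    ∑ u, ∑ v, (L * (if k u = k v then (1 : ℝ) else 0) - 1) = L * ∑ a, deviation L k a ^ 2 := by
  have hL0 : (L : ℝ) ≠ 0 := by exact_mod_cast (by omega : L ≠ 0)
  have h1 : ∑ a, deviation L k a ^ 2 = ∑ u, (deviation L k (k u) - (∑ a, deviation L k a) / L) := by
    rw [← sum_deviation_mul]; simp_rw [sq]
  have h0 : ∑ a, deviation L k a = 0 := by
    have := sum_deviation_mul L k fun _ => 1
    simp only [mul_one, Finset.sum_const, Finset.card_univ, hcard, nsmul_eq_mul] at this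
    rw [this, div_self hL0]; simp
  rw [h1, h0, Finset.mul_sum]
  refine Finset.sum_congr rfl fun u _ => ?_
  rw [Finset.sum_sub_distrib, ← Finset.mul_sum, deviation]
  simp only [Finset.sum_const, Finset.card_univ, Fintype.card_fin, nsmul_eq_mul, eq_comm]
  field_simp
  ring

open scoped Classical in
theorem prod_edge_le {G : Type*} [Fintype G] {L : ℕ} (hcard : Fintype.card G = L) (hL : 2 ≤ L)
    {n : ℕ} (k : Fin n → G) {p q : ℝ} (hp0 : 0 ≤ p) (hp1 : p ≤ 1) (hpq : p ^ 2 ≤ q) :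
    ∏ e : Edge n, (1 + p ^ 2 * (L * (if k e.1.1 = k e.1.2 then (1 : ℝ) else 0) - 1))
      ≤ Real.exp (q * L / 2 * ∑ a, deviation L k a ^ 2) := by
  have hL1 : (1 : ℝ) ≤ L := by exact_mod_cast (by omega : 1 ≤ L)
  calc ∏ e : Edge n, (1 + p ^ 2 * (L * (if k e.1.1 = k e.1.2 then (1 : ℝ) else 0) - 1))
      ≤ ∏ e : Edge n, Real.exp (p ^ 2 * (L * (if k e.1.1 = k e.1.2 then (1 : ℝ) else 0) - 1)) := by
        refine Finset.prod_le_prod (fun e _ => ?_) fun e _ => ?_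
        · have : p ^ 2 ≤ 1 := pow_le_one₀ hp0 hp1
          split_ifs
          · nlinarith [sq_nonneg p]
          · linarith
        · rw [add_comm]; exact Real.add_one_le_exp _
    _ = Real.exp (p ^ 2 * ∑ e : Edge n, (L * (if k e.1.1 = k e.1.2 then (1 : ℝ) else 0) - 1)) := by
        rw [← Real.exp_sum, Finset.mul_sum]
    _ ≤ Real.exp (q * L / 2 * ∑ a, deviation L k a ^ 2) := by
        have h := two_mul_sum_edge_le (fun u v => L * (if k u = k v then (1 : ℝ) else 0) - 1)
          (fun u v => by simp only [eq_comm]) (fun u => by simpa using hL1)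
        rw [sum_pairs_eq hcard hL] at h
        have hdev : 0 ≤ ∑ a, deviation L k a ^ 2 := Finset.sum_nonneg fun a _ => sq_nonneg _
        refine Real.exp_le_exp.2 ?_
        calc _ ≤ p ^ 2 * (L / 2 * ∑ a, deviation L k a ^ 2) := by gcongr; linarith
          _ ≤ q * (L / 2 * ∑ a, deviation L k a ^ 2) := by gcongr
          _ = _ := by ring


/-! ### The law of the model as a finite sum of likelihood ratios. -/

/-- The matrix with the given entries above the diagonal. -/
def toMatrix {G : Type*} [Group G] {n : ℕ} (y : Edge n → G) : Fin n → Fin n → G :=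
  fun u v =>
    if h : u < v then y ⟨(u, v), h⟩
    else if h : v < u then (y ⟨(v, u), h⟩)⁻¹
    else 1

/-- The entries above the diagonal of the observed matrix. -/
def edgeObs {G : Type*} [Group G] {n : ℕ} (g : Fin n → G) (b : Edge n → Bool) (r : Edge n → G) :
    Edge n → G :=
  fun e => if b e = true then g e.1.1 * (g e.1.2)⁻¹ else r e

theorem observe_eq {G : Type*} [Group G] {n : ℕ} (g : Fin n → G) (b : Edge n → Bool)
    (r : Edge n → G) : observe g b r = toMatrix (edgeObs g b r) := rfl

open scoped Classical in
/-- The density, given the labels `g`, of the entries above the diagonal with respect to the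
uniform law. -/
noncomputable def edgeDensity {G : Type*} [Group G] (L : ℕ) (p : ℝ) {n : ℕ} (g : Fin n → G)
    (e : Edge n) (a : G) : ℝ :=
  1 - p + p * L * (if a = g e.1.1 * (g e.1.2)⁻¹ then 1 else 0)

/-- The likelihood ratio of the entries above the diagonal. -/
noncomputable def likelihood {G : Type*} [Group G] [Fintype G] (L : ℕ) (p : ℝ) {n : ℕ}
    (y : Edge n → G) : ℝ :=
  ((L : ℝ) ^ n)⁻¹ * ∑ g : Fin n → G, ∏ e, edgeDensity L p g e (y e)

open scoped Classical in
-- Given the labels the edges are independent, so the sum over coins and replacements factors into a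
-- two-case sum per edge.
theorem sum_edgeObs_eq {G : Type*} [Group G] [Fintype G] {L : ℕ}
    (hcard : Fintype.card G = L) (hL : L ≠ 0) (p : ℝ) {n : ℕ} (g : Fin n → G) (y : Edge n → G) :
    ∑ b : Edge n → Bool, ∑ r : Edge n → G,
      (if edgeObs g b r = y then ∏ e, ((if b e = true then p else 1 - p) * (L : ℝ)⁻¹) else 0)
      = ∏ e, ((L : ℝ)⁻¹ * edgeDensity L p g e (y e)) := by
  have hL0 : (L : ℝ) ≠ 0 := by exact_mod_cast hL
  have h : ∀ e : Edge n, (L : ℝ)⁻¹ * edgeDensity L p g e (y e)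
      = ∑ β : Bool, ∑ ρ : G, if (if β = true then g e.1.1 * (g e.1.2)⁻¹ else ρ) = y e then
          (if β = true then p else 1 - p) * (L : ℝ)⁻¹ else 0 := by
    intro e
    simp only [Fintype.sum_bool, edgeDensity, if_true, Finset.sum_const, Finset.card_univ, hcard,
      nsmul_eq_mul, Bool.false_eq_true, if_false, Finset.sum_ite_eq', Finset.mem_univ,
      eq_comm (a := y e)]
    split_ifs <;> field_simp <;> ring
  simp_rw [h]
  rw [Finset.prod_univ_sum, Fintype.piFinset_univ]
  refine Finset.sum_congr rfl fun b _ => ?_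
  rw [Finset.prod_univ_sum, Fintype.piFinset_univ]
  refine Finset.sum_congr rfl fun r _ => ?_
  by_cases hy : edgeObs g b r = y
  · rw [if_pos hy]
    refine Finset.prod_congr rfl fun e _ => ?_
    exact (if_pos (congrFun hy e)).symm
  · rw [if_neg hy]
    obtain ⟨e, he⟩ := Function.ne_iff.1 hy
    exact (Finset.prod_eq_zero (Finset.mem_univ e) (if_neg he)).symm

section Law

variable {G : Type*} [Group G] [Fintype G] [MeasurableSpace G] [DiscreteMeasurableSpace G]

instance : IsProbabilityMeasure (haarUniform G) := by
  unfold haarUniform; infer_instance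

theorem haarUniform_real_singleton {L : ℕ} (hcard : Fintype.card G = L) (a : G) :
    (haarUniform G).real {a} = (L : ℝ)⁻¹ := by
  rw [haarUniform, measureReal_def, PMF.toMeasure_apply_singleton _ _ (measurableSet_singleton a),
    PMF.uniformOfFintype_apply, hcard]
  simp

theorem pi_haarUniform_real_singleton {L : ℕ} (hcard : Fintype.card G = L) {ι : Type*} [Fintype ι]
    (g : ι → G) :
    (Measure.pi fun _ : ι => haarUniform G).real {g} = ((L : ℝ) ^ Fintype.card ι)⁻¹ := by
  have h := fun a : G => haarUniform_real_singleton hcard a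
  simp only [measureReal_def] at h ⊢
  rw [Measure.pi_singleton, ENNReal.toReal_prod]
  simp_rw [h]
  simp

theorem pi_bernoulli_real_singleton {ι : Type*} [Fintype ι] (p : unitInterval) (b : ι → Bool) :
    (Measure.pi fun _ : ι => bernoulliMeasure true false p).real {b}
      = ∏ i, (if b i = true then (p : ℝ) else 1 - p) := by
  rw [measureReal_def, Measure.pi_singleton, ENNReal.toReal_prod]
  refine Finset.prod_congr rfl fun i _ => ?_
  rw [← measureReal_def, bernoulliMeasure_real_apply p (measurableSet_singleton _)]
  cases b i <;> simp

theorem prod_real_singleton {L : ℕ} (hcard : Fintype.card G = L) (p : unitInterval) {n : ℕ}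
    (g : Fin n → G) (b : Edge n → Bool) (r : Edge n → G) :
    ((Measure.pi fun _ : Fin n => haarUniform G).prod
      ((Measure.pi fun _ : Edge n => bernoulliMeasure true false p).prod
        (Measure.pi fun _ : Edge n => haarUniform G))).real {(g, b, r)}
      = ((L : ℝ) ^ n)⁻¹ * ∏ e, ((if b e = true then (p : ℝ) else 1 - p) * (L : ℝ)⁻¹) := by
  rw [← Set.singleton_prod_singleton, ← Set.singleton_prod_singleton, measureReal_prod_prod,
    measureReal_prod_prod, pi_haarUniform_real_singleton hcard, pi_haarUniform_real_singleton hcard,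
    pi_bernoulli_real_singleton, Fintype.card_fin, Finset.prod_mul_distrib, Finset.prod_const,
    Finset.card_univ, inv_pow]

open scoped Classical in
theorem model_real_apply {L : ℕ} (hcard : Fintype.card G = L) (hL : L ≠ 0) (pt : ℝ) (n : ℕ)
    (A : Set (Fin n → Fin n → G)) :
    (model G pt n).real A = ∑ y : Edge n → G with toMatrix y ∈ A,
      ((L : ℝ) ^ Fintype.card (Edge n))⁻¹ * likelihood L (truthProb pt n) y := by
  have hL0 : (L : ℝ) ≠ 0 := by exact_mod_cast hL
  rw [model, map_measureReal_apply .of_discrete .of_discrete]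
  set μ := (Measure.pi fun _ : Fin n => haarUniform G).prod
      ((Measure.pi fun _ : Edge n => bernoulliMeasure true false (truthProb pt n)).prod
        (Measure.pi fun _ : Edge n => haarUniform G)) with hμ
  set s : Finset ((Fin n → G) × (Edge n → Bool) × (Edge n → G)) :=
    Finset.univ.filter fun ω => toMatrix (edgeObs ω.1 ω.2.1 ω.2.2) ∈ A with hs
  have hpre : (fun ω : (Fin n → G) × (Edge n → Bool) × (Edge n → G) =>
      observe ω.1 ω.2.1 ω.2.2) ⁻¹' A = (s : Set _) := by
    ext ω; simp [hs, observe_eq]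
  rw [hpre, ← sum_measureReal_singleton, hs, Finset.sum_filter, Fintype.sum_prod_type]
  simp_rw [Fintype.sum_prod_type]
  simp only [hμ, prod_real_singleton hcard]
  have hind : ∀ (g : Fin n → G) (b : Edge n → Bool) (r : Edge n → G) (w : ℝ),
      (if toMatrix (edgeObs g b r) ∈ A then ((L : ℝ) ^ n)⁻¹ * w else 0)
        = ∑ y : Edge n → G with toMatrix y ∈ A,
          ((L : ℝ) ^ n)⁻¹ * (if edgeObs g b r = y then w else 0) := by
    intro g b r w
    rw [← Finset.mul_sum, Finset.sum_ite_eq]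
    simp [mul_ite]
  simp_rw [hind]
  have hswap : ∀ F : (Fin n → G) → (Edge n → Bool) → (Edge n → G) → (Edge n → G) → ℝ,
      ∑ g, ∑ b, ∑ r, ∑ y with toMatrix y ∈ A, F g b r y
        = ∑ y with toMatrix y ∈ A, ∑ g, ∑ b, ∑ r, F g b r y := by
    intro F
    rw [Finset.sum_comm]
    simp_rw [Finset.sum_comm (t := Finset.univ.filter fun y : Edge n → G => toMatrix y ∈ A)]
    exact Finset.sum_congr rfl fun y _ => Finset.sum_comm
  rw [hswap]
  refine Finset.sum_congr rfl fun y _ => ?_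
  simp_rw [← Finset.mul_sum, sum_edgeObs_eq hcard hL, Finset.prod_mul_distrib, Finset.prod_const,
    Finset.card_univ, ← Finset.mul_sum, likelihood, inv_pow]
  ring

end Law

/-! ### The second moment of the likelihood ratio. -/

section SecondMoment

variable {G : Type*} [Group G] [Fintype G]

theorem likelihood_zero {L : ℕ} (hcard : Fintype.card G = L) (hL : L ≠ 0) {n : ℕ}
    (y : Edge n → G) : likelihood L 0 y = 1 := by
  have hL0 : (L : ℝ) ≠ 0 := by exact_mod_cast hL
  simp [likelihood, edgeDensity, hcard, hL0]

open scoped Classical in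
-- The truths agree on an edge, g_u g_v⁻¹ = h_u h_v⁻¹, exactly when h⁻¹g takes equal values at its
-- ends. This holds without commutativity and leaves a function of h⁻¹g alone.
theorem sum_edgeDensity_mul {L : ℕ} (hcard : Fintype.card G = L) (p : ℝ) {n : ℕ}
    (g h : Fin n → G) (e : Edge n) :
    ∑ a, edgeDensity L p g e a * edgeDensity L p h e a
      = L * (1 + p ^ 2 * (L * (if (h⁻¹ * g) e.1.1 = (h⁻¹ * g) e.1.2 then 1 else 0) - 1)) := by
  have hiff : (h⁻¹ * g) e.1.1 = (h⁻¹ * g) e.1.2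
      ↔ g e.1.1 * (g e.1.2)⁻¹ = h e.1.1 * (h e.1.2)⁻¹ := by
    simp only [Pi.mul_apply, Pi.inv_apply]
    rw [inv_mul_eq_iff_eq_mul, mul_inv_eq_iff_eq_mul, mul_assoc]
  have hmul : ∀ a, edgeDensity L p g e a * edgeDensity L p h e a
      = (1 - p) ^ 2 + (if a = g e.1.1 * (g e.1.2)⁻¹ then (1 - p) * (p * L) + (p * L) ^ 2 *
          (if g e.1.1 * (g e.1.2)⁻¹ = h e.1.1 * (h e.1.2)⁻¹ then 1 else 0) else 0)
        + (if a = h e.1.1 * (h e.1.2)⁻¹ then (1 - p) * (p * L) else 0) := by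
    intro a
    unfold edgeDensity
    split_ifs <;> first | ring1 | (exfalso; simp_all)
  simp_rw [hmul, hiff]
  rw [Finset.sum_add_distrib, Finset.sum_add_distrib, Finset.sum_ite_eq', Finset.sum_ite_eq']
  simp only [Finset.mem_univ, if_true, Finset.sum_const, Finset.card_univ, hcard, nsmul_eq_mul]
  ring

/-- The second moment of the likelihood ratio is an average over one family of uniform labels. -/
theorem sum_likelihood_sq_le {L : ℕ} (hcard : Fintype.card G = L) (hL : 2 ≤ L) {p q : ℝ}
    (hp0 : 0 ≤ p) (hp1 : p ≤ 1) (hpq : p ^ 2 ≤ q) {n : ℕ} :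
    ∑ y : Edge n → G, ((L : ℝ) ^ Fintype.card (Edge n))⁻¹ * likelihood L p y ^ 2
      ≤ ((L : ℝ) ^ n)⁻¹ *
        ∑ k : Fin n → G, Real.exp (q * L / 2 * ∑ a, deviation L k a ^ 2) := by
  classical
  have hL0 : (L : ℝ) ≠ 0 := by exact_mod_cast (by omega : L ≠ 0)
  set F : (Fin n → G) → ℝ := fun k =>
    ∏ e : Edge n, (1 + p ^ 2 * (L * (if k e.1.1 = k e.1.2 then (1 : ℝ) else 0) - 1)) with hF
  have h1 : ∀ g h : Fin n → G,
      ∑ y : Edge n → G, ∏ e, (edgeDensity L p g e (y e) * edgeDensity L p h e (y e))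
        = (L : ℝ) ^ Fintype.card (Edge n) * F (h⁻¹ * g) := by
    intro g h
    rw [← Fintype.piFinset_univ, ← Finset.prod_univ_sum (fun _ => Finset.univ)
      fun e a => edgeDensity L p g e a * edgeDensity L p h e a]
    simp_rw [sum_edgeDensity_mul hcard p g h]
    rw [Finset.prod_mul_distrib, Finset.prod_const, Finset.card_univ]
  have h2 : ∑ y : Edge n → G, ((L : ℝ) ^ Fintype.card (Edge n))⁻¹ * likelihood L p y ^ 2
      = ((L : ℝ) ^ n)⁻¹ ^ 2 * ∑ h : Fin n → G, ∑ g : Fin n → G, F (h⁻¹ * g) := by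
    simp_rw [likelihood, mul_pow, sq (∑ g : Fin n → G, _), Finset.sum_mul_sum,
      ← Finset.prod_mul_distrib]
    rw [← Finset.mul_sum, ← Finset.mul_sum, Finset.sum_comm]
    simp_rw [Finset.sum_comm (s := (Finset.univ : Finset (Edge n → G))), h1, ← Finset.mul_sum]
    rw [Finset.sum_comm]
    field_simp
  have h3 : ∀ h : Fin n → G, ∑ g : Fin n → G, F (h⁻¹ * g) = ∑ k, F k := fun h =>
    Equiv.sum_comp (Equiv.mulLeft h⁻¹) F
  rw [h2]
  simp_rw [h3]
  rw [Finset.sum_const, Finset.card_univ, Fintype.card_fun, hcard, Fintype.card_fin, nsmul_eq_mul]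
  push_cast
  calc ((L : ℝ) ^ n)⁻¹ ^ 2 * ((L : ℝ) ^ n * ∑ k, F k) = ((L : ℝ) ^ n)⁻¹ * ∑ k, F k := by
        field_simp
    _ ≤ _ := by
        gcongr with k
        exact prod_edge_le hcard hL k hp0 hp1 hpq

end SecondMoment

/-! ### Cauchy–Schwarz and contiguity. -/

theorem truthProb_zero (n : ℕ) : (truthProb 0 n : ℝ) = 0 := by
  simp [truthProb]

theorem truthProb_sq_le {pt : ℝ} (h0 : 0 ≤ pt) (n : ℕ) :
    (truthProb pt n : ℝ) ^ 2 ≤ pt ^ 2 / n := by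
  have h : (truthProb pt n : ℝ) ≤ pt / √n := by
    rw [truthProb, Set.coe_projIcc]
    exact max_le (by positivity) (min_le_right _ _)
  calc (truthProb pt n : ℝ) ^ 2 ≤ (pt / √n) ^ 2 := by
        gcongr; exact (truthProb pt n).2.1
    _ = pt ^ 2 / n := by rw [div_pow, Real.sq_sqrt n.cast_nonneg]

/-- The second-moment bound for the probability of an event. -/
theorem model_real_sq_le {G : Type*} [Group G] [Fintype G] [MeasurableSpace G]
    [DiscreteMeasurableSpace G] {L : ℕ} (hcard : Fintype.card G = L) (hL : 2 ≤ L) {pt : ℝ}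
    (h0 : 0 ≤ pt) (hpt : pt < threshold L) {n : ℕ} (hn : 1 ≤ n) (A : Set (Fin n → Fin n → G)) :
    (model G pt n).real A ^ 2
      ≤ (model G 0 n).real A * √(1 / (1 - pt ^ 2 * L / 2 / entropyConst L)) ^ L := by
  classical
  have hLn : L ≠ 0 := by omega
  have hL0 : (0 : ℝ) < L := by exact_mod_cast (by omega : 0 < L)
  rw [model_real_apply hcard hLn, model_real_apply hcard hLn]
  simp_rw [truthProb_zero, likelihood_zero hcard hLn, mul_one]
  set N := ((L : ℝ) ^ Fintype.card (Edge n))⁻¹ with hN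
  have hN0 : 0 ≤ N := by positivity
  set p : ℝ := (truthProb pt n : ℝ) with hp
  -- Cauchy–Schwarz with (N ℓ)² = N · (N ℓ²); the first sum is the unspiked probability of the
  -- event.
  refine (Finset.sum_sq_le_sum_mul_sum_of_sq_le_mul _ (fun _ _ => hN0)
    (fun y _ => mul_nonneg hN0 (sq_nonneg (likelihood L p y))) fun y _ => le_of_eq (by ring)).trans ?_
  refine mul_le_mul_of_nonneg_left ?_ (Finset.sum_nonneg fun _ _ => hN0)
  calc ∑ y : Edge n → G with toMatrix y ∈ A, N * likelihood L p y ^ 2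
      ≤ ∑ y : Edge n → G, N * likelihood L p y ^ 2 :=
        Finset.sum_le_sum_of_subset_of_nonneg (Finset.filter_subset _ _)
          fun y _ _ => mul_nonneg hN0 (sq_nonneg _)
    _ ≤ ((L : ℝ) ^ n)⁻¹ * ∑ k : Fin n → G,
          Real.exp (pt ^ 2 / n * L / 2 * ∑ a, deviation L k a ^ 2) :=
        sum_likelihood_sq_le hcard hL (truthProb pt n).2.1 (truthProb pt n).2.2
          (truthProb_sq_le h0 n)
    _ ≤ ((L : ℝ) ^ n)⁻¹ * ((L : ℝ) ^ n *
          √(1 / (1 - pt ^ 2 * L / 2 / entropyConst L)) ^ L) := by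
        gcongr
        have := sum_exp_deviation_sq_le hcard hL (β := pt ^ 2 * L / 2) (by positivity)
          (sq_mul_lt_entropyConst hL h0 hpt) hn
        refine le_of_eq_of_le (Finset.sum_congr rfl fun k _ => ?_) this
        congr 2
        ring
    _ = _ := by field_simp

instance {G : Type*} [Group G] [Fintype G] [MeasurableSpace G] [DiscreteMeasurableSpace G]
    (pt : ℝ) (n : ℕ) : IsProbabilityMeasure (model G pt n) := by
  unfold model
  exact Measure.isProbabilityMeasure_map Measurable.of_discrete.aemeasurable

end ToH

theorem mainTheorem10 {G : Type*} [Group G] [Fintype G]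
    [MeasurableSpace G] [DiscreteMeasurableSpace G]
    (L : ℕ) (hcard : Fintype.card G = L) (hL : 2 ≤ L)
    (pt : ℝ) (hpt0 : 0 ≤ pt) (hpt : pt < ToH.threshold L) :
    IsContiguousTo (fun n => ToH.model G pt n) (fun n => ToH.model G 0 n) := by
  intro A _ hQ
  set M := √(1 / (1 - pt ^ 2 * L / 2 / ToH.entropyConst L)) ^ L
  have hQ' : Tendsto (fun n => √((ToH.model G 0 n).real (A n) * M)) atTop (𝓝 0) := by
    have h1 : Tendsto (fun n => (ToH.model G 0 n).real (A n)) atTop (𝓝 0) := by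
      simpa [measureReal_def, Function.comp_def] using (ENNReal.tendsto_toReal ENNReal.zero_ne_top).comp hQ
    simpa using (h1.mul_const M).sqrt
  have hP : Tendsto (fun n => (ToH.model G pt n).real (A n)) atTop (𝓝 0) := by
    refine tendsto_of_tendsto_of_tendsto_of_le_of_le' tendsto_const_nhds hQ'
      (.of_forall fun n => measureReal_nonneg) ?_
    filter_upwards [eventually_ge_atTop 1] with n hn
    exact Real.le_sqrt_of_sq_le (ToH.model_real_sq_le hcard hL hpt0 hpt hn (A n))
  have := ENNReal.tendsto_ofReal hP
  simpa [ofReal_measureReal] using this
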